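/- Let $\Theta=\mathbb R^d$ with Lebesgue measure, let $\mathcal F$ be a real Hilbert space, let $R:\mathcal F\to[0,\infty)$ be convex and Fréchet differentiable, and let $\Psi:\Theta\to\mathcal F$ be such that $\langle\Psi,\rho\rangle:=\int_\Theta\rho(\theta)\Psi(\theta)\,d\theta$ is a convergent Bochner integral for every $\rho\in L^1(\Theta)$. Let $g:\Theta\to[0,\infty)$, and put $$F_0(\rho)=R(\langle\Psi,\rho\rangle),\qquad F(\rho)=F_0(\rho)+\int_\Theta g\,\rho,$$ with differentials, as functions of $\theta\in\Theta$, $$F_0'(\rho)(\theta)=R'(\langle\Psi,\rho\rangle)\,[\Psi(\theta)],\qquad F'(\rho)(\theta)=F_0'(\rho)(\theta)+g(\theta)\qquad(\rho\in L^1(\Theta)).$$ Assume that * the family of functions $\{F_0'(\rho):\rho\in L^1(\Theta),\ \|\rho\|_1\le 1\}$ on $\Theta$ is uniformly equicontinuous and uniformly bounded; * $g$ is differentiable and confining, i.e. $g(\theta)\to\infty$ as $|\theta|\to\infty$ and $\exp(-bg)$ is integrable for every $b>0$. Let $\beta>0$ and let $\mathcal P(\Theta)=\{\rho\in L^1(\Theta):\rho\ge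 0 \text{ a.e.},\ \int_\Theta\rho=1\}$ be the set of probability densities on $\Theta$ (identified when equal a.e.). Then for every $\rho\in\mathcal P(\Theta)$ the function $\exp(-\beta F'(\rho))$ is integrable with $Z_2(\rho):=\int_\Theta\exp(-\beta F'(\rho)(\theta))\,d\theta>0$, so that $$T:\mathcal P(\Theta)\to\mathcal P(\Theta),\qquad T(\rho)(\theta)=\frac{\exp(-\beta F'(\rho)(\theta))}{Z_2(\rho)},$$ is well defined, and $T$ has exactly one fixed point. -/

import Mathlib

open MeasureTheory Filter Topology

namespace MeanField

noncomputable section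

/-- The parameter space `ℝ^d` with its Euclidean norm (and Lebesgue measure `volume`). -/
abbrev Param (d : ℕ) : Type := EuclideanSpace ℝ (Fin d)

/-- The space `L¹` of (classes of) Lebesgue integrable functions on the parameter space. -/
abbrev L1 (d : ℕ) : Type := Lp ℝ 1 (volume : Measure (Param d))

/-- The set of probability density functions, as a subset of `L¹`. -/
def densities (d : ℕ) : Set (L1 d) :=
  {ρ | (∀ᵐ θ ∂(volume : Measure (Param d)), 0 ≤ ρ θ) ∧ ∫ θ, ρ θ = 1}

/-- `g` is confining: it tends to infinity at infinity and `exp (-β g)` is integrable for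
every `β > 0`. -/
def IsConfining {d : ℕ} (g : Param d → ℝ) : Prop :=
  Tendsto g (comap (fun θ => ‖θ‖) atTop) atTop ∧
    ∀ β : ℝ, 0 < β → Integrable (fun θ => Real.exp (-β * g θ))

section Functionals

variable {d : ℕ} {E : Type*} [NormedAddCommGroup E] [InnerProductSpace ℝ E]

/-- The pairing `⟨Ψ, ρ⟩ = ∫ Ψ(θ) ρ(θ) dθ`, an element of the feature space. -/
def pairing (Ψ : Param d → E) (ρ : L1 d) : E := ∫ θ, ρ θ • Ψ θ

/-- The unregularized risk `F₀(ρ) = R(⟨Ψ, ρ⟩)`. -/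
def risk (R : E → ℝ) (Ψ : Param d → E) (ρ : L1 d) : ℝ := R (pairing Ψ ρ)

/-- The regularized risk `F(ρ) = F₀(ρ) + ⟨g, ρ⟩`. -/
def regRisk (R : E → ℝ) (Ψ : Param d → E) (g : Param d → ℝ) (ρ : L1 d) : ℝ :=
  risk R Ψ ρ + ∫ θ, g θ * ρ θ

/-- The differential `F₀'(ρ)`, as the function `θ ↦ ⟨R'(⟨Ψ, ρ⟩), Ψ(θ)⟩` of the parameter.
`hasFDerivAt_risk` shows that it represents the Fréchet differential of `risk` on `L¹`. -/
def riskDeriv (R : E → ℝ) (Ψ : Param d → E) (ρ : L1 d) (θ : Param d) : ℝ :=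
  fderiv ℝ R (pairing Ψ ρ) (Ψ θ)

/-- The differential `F'(ρ) = F₀'(ρ) + g`, as a function of the parameter.
See `hasDerivAt_regRisk`. -/
def regRiskDeriv (R : E → ℝ) (Ψ : Param d → E) (g : Param d → ℝ) (ρ : L1 d)
    (θ : Param d) : ℝ :=
  riskDeriv R Ψ ρ θ + g θ

/-- The unnormalized Boltzmann weight `exp (-β F'(ρ)(θ))`. -/
def boltzmannWeight (R : E → ℝ) (Ψ : Param d → E) (g : Param d → ℝ) (β : ℝ) (ρ : L1 d)
    (θ : Param d) : ℝ :=
  Real.exp (-β * regRiskDeriv R Ψ g ρ θ)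

/-- The normalizing constant `Z₂(ρ) = ∫ exp (-β F'(ρ)(θ)) dθ`. -/
def partitionFn (R : E → ℝ) (Ψ : Param d → E) (g : Param d → ℝ) (β : ℝ) (ρ : L1 d) : ℝ :=
  ∫ θ, boltzmannWeight R Ψ g β ρ θ

/-- The pairing `⟨Ψ, ρ⟩` is a Bochner integral that converges for every `ρ ∈ L¹`, so that
`F₀` and `F₀'` are defined on all of `L¹`. -/
def PairingDefined (Ψ : Param d → E) : Prop :=
  ∀ ρ : L1 d, Integrable (fun θ => ρ θ • Ψ θ)

/-! ### The functions above represent the differentials of the functionals -/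

theorem pairing_add_smul {Ψ : Param d → E} (hΨ : PairingDefined Ψ) (c : ℝ) (ρ h : L1 d) :
    pairing Ψ (ρ + c • h) = pairing Ψ ρ + c • pairing Ψ h := by
  unfold pairing
  have hc : Integrable (fun θ => c • h θ • Ψ θ) := (hΨ h).smul c
  rw [← integral_smul, ← integral_add (hΨ ρ) hc]
  apply integral_congr_ae
  filter_upwards [Lp.coeFn_add ρ (c • h), Lp.coeFn_smul c h] with θ h1 h2
  rw [h1, Pi.add_apply, h2, Pi.smul_apply, add_smul, smul_eq_mul, mul_smul]

/-- The pairing as a linear map on `L¹`. -/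
def pairingLin {Ψ : Param d → E} (hΨ : PairingDefined Ψ) : L1 d →ₗ[ℝ] E where
  toFun := pairing Ψ
  map_add' ρ h := by simpa using pairing_add_smul hΨ 1 ρ h
  map_smul' c h := by
    have h0 : pairing Ψ (0 : L1 d) = 0 := by
      have := pairing_add_smul hΨ 1 (0 : L1 d) 0
      simpa using this
    simpa [h0] using pairing_add_smul hΨ c 0 h

theorem pairingLin_apply {Ψ : Param d → E} (hΨ : PairingDefined Ψ) (ρ : L1 d) :
    pairingLin hΨ ρ = pairing Ψ ρ := rfl

/-- By the closed graph theorem, a pairing that is defined on all of `L¹` is continuous. -/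
theorem continuous_pairing [CompleteSpace E] {Ψ : Param d → E} (hΨ : PairingDefined Ψ) :
    Continuous (pairing Ψ : L1 d → E) := by
  let Φ : L1 d →ₗ[ℝ] (Lp E 1 (volume : Measure (Param d))) :=
    { toFun := fun ρ => (hΨ ρ).toL1 _
      map_add' := fun ρ h => by
        rw [← Integrable.toL1_add, Integrable.toL1_eq_toL1_iff]
        filter_upwards [Lp.coeFn_add ρ h] with θ h1
        change (ρ + h : L1 d) θ • Ψ θ = ρ θ • Ψ θ + h θ • Ψ θ
        rw [h1, Pi.add_apply, add_smul]
      map_smul' := fun c h => by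
        rw [RingHom.id_apply, ← Integrable.toL1_smul, Integrable.toL1_eq_toL1_iff]
        filter_upwards [Lp.coeFn_smul c h] with θ h1
        simp [h1, mul_smul] }
  have hΦ : ∀ ρ : L1 d, (Φ ρ : Param d → E) =ᵐ[volume] fun θ => ρ θ • Ψ θ :=
    fun ρ => Integrable.coeFn_toL1 (hΨ ρ)
  have hc : Continuous Φ := by
    refine Φ.continuous_of_seq_closed_graph fun u ρ k hu hk => ?_
    obtain ⟨ns, hns, hae⟩ := (tendstoInMeasure_of_tendsto_Lp hu).exists_seq_tendsto_ae
    have hk' : Tendsto (fun n => Φ (u (ns n))) atTop (𝓝 k) := hk.comp hns.tendsto_atTop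
    obtain ⟨ms, hms, hae'⟩ := (tendstoInMeasure_of_tendsto_Lp hk').exists_seq_tendsto_ae
    apply Lp.ext
    have hall : ∀ᵐ θ ∂(volume : Measure (Param d)), ∀ n, Φ (u n) θ = u n θ • Ψ θ :=
      ae_all_iff.2 fun n => hΦ (u n)
    filter_upwards [hae, hae', hall, hΦ ρ] with θ h1 h2 h3 h4
    rw [h4]
    refine tendsto_nhds_unique h2 ?_
    simp only [h3]
    exact (h1.comp hms.tendsto_atTop).smul_const _
  have : (pairing Ψ : L1 d → E) = fun ρ => ∫ θ, Φ ρ θ := by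
    funext ρ
    exact integral_congr_ae (hΦ ρ).symm
  rw [this]
  exact continuous_integral.comp hc

/-- Chain rule: `F₀` is Fréchet differentiable on `L¹` and its differential at `ρ` is the
integration against `riskDeriv R Ψ ρ`. -/
theorem hasFDerivAt_risk [CompleteSpace E] {R : E → ℝ} {Ψ : Param d → E}
    (hR : Differentiable ℝ R) (hΨ : PairingDefined Ψ) (ρ : L1 d) :
    ∃ D : L1 d →L[ℝ] ℝ, HasFDerivAt (risk R Ψ) D ρ ∧
      ∀ h : L1 d, D h = ∫ θ, riskDeriv R Ψ ρ θ * h θ := by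
  let L : L1 d →L[ℝ] E := ⟨pairingLin hΨ, continuous_pairing hΨ⟩
  refine ⟨(fderiv ℝ R (pairing Ψ ρ)).comp L, ?_, fun h => ?_⟩
  · exact HasFDerivAt.comp (g := R) (f := L) ρ (hR _).hasFDerivAt L.hasFDerivAt
  · change fderiv ℝ R (pairing Ψ ρ) (∫ θ, h θ • Ψ θ) = _
    rw [← ContinuousLinearMap.integral_comp_comm _ (hΨ h)]
    simp [riskDeriv, mul_comm]

/-- The function `regRiskDeriv R Ψ g ρ` represents the directional derivatives of `F` at `ρ`,
in the directions in which the linear term `⟨g, ·⟩` is finite. -/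
theorem hasDerivAt_regRisk [CompleteSpace E] {R : E → ℝ} {Ψ : Param d → E} {g : Param d → ℝ}
    (hR : Differentiable ℝ R) (hΨ : PairingDefined Ψ) (ρ h : L1 d)
    (hρ : Integrable (fun θ => g θ * ρ θ)) (hh : Integrable (fun θ => g θ * h θ)) :
    HasDerivAt (fun t : ℝ => regRisk R Ψ g (ρ + t • h))
      (∫ θ, regRiskDeriv R Ψ g ρ θ * h θ) 0 := by
  obtain ⟨D, hD, hDh⟩ := hasFDerivAt_risk hR hΨ ρ
  have hint : Integrable (fun θ => riskDeriv R Ψ ρ θ * h θ) := by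
    have := (fderiv ℝ R (pairing Ψ ρ)).integrable_comp (hΨ h)
    simpa [riskDeriv, mul_comm] using this
  have hline : HasDerivAt (fun t : ℝ => ρ + t • h) h 0 := by
    simpa using ((hasDerivAt_id (0 : ℝ)).smul_const h).const_add ρ
  have h1 : HasDerivAt (fun t : ℝ => risk R Ψ (ρ + t • h)) (D h) 0 := by
    have hD' : HasFDerivAt (risk R Ψ) D (ρ + (0 : ℝ) • h) := by simpa using hD
    exact hD'.comp_hasDerivAt (0 : ℝ) hline
  have h2 : (fun t : ℝ => ∫ θ, g θ * (ρ + t • h : L1 d) θ)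
      = fun t : ℝ => (∫ θ, g θ * ρ θ) + t * ∫ θ, g θ * h θ := by
    funext t
    rw [← integral_const_mul, ← integral_add hρ (hh.const_mul t)]
    apply integral_congr_ae
    filter_upwards [Lp.coeFn_add ρ (t • h), Lp.coeFn_smul t h] with θ e1 e2
    simp only [e1, Pi.add_apply, e2, Pi.smul_apply, smul_eq_mul]
    ring
  have h3 : HasDerivAt (fun t : ℝ => ∫ θ, g θ * (ρ + t • h : L1 d) θ) (∫ θ, g θ * h θ) 0 := by
    rw [h2]
    simpa using ((hasDerivAt_id (0 : ℝ)).mul_const (∫ θ, g θ * h θ)).const_add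
      (∫ θ, g θ * ρ θ)
  have h4 : ∫ θ, regRiskDeriv R Ψ g ρ θ * h θ = D h + ∫ θ, g θ * h θ := by
    rw [hDh, ← integral_add hint hh]
    simp only [regRiskDeriv, add_mul]
  rw [h4]
  exact h1.add h3

end Functionals

end

end MeanField

/-!
Write `w = exp (-β g)`. The fixed points of `T` are the minimizers of the free energy
`ρ ↦ β F₀(ρ) + ∫ ρ log (ρ / w) + w - ρ` over the probability densities: `F₀` being convex, a density
`ρ` minimizes the free energy if and only if it minimizes its linearization, in which `F₀` is
replaced by its differential at `ρ`, and by Gibbs' variational principle the only minimizer of the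
latter is proportional to `exp (-β F₀'(ρ)) w`. A minimizer exists and is unique because the free
energy is strongly convex for the norm of `L¹` and has closed sublevel sets. By duality, `F₀'(ρ)` is
essentially bounded, hence `exp (-β F₀'(ρ)) w` is integrable.
-/

namespace MeanField

open InformationTheory
open scoped ENNReal

section ConvexAnalysis

variable {X : Type*} [NormedAddCommGroup X] [NormedSpace ℝ X] {K : Set X} {x y : X}

theorem tendsto_slope_segment_of_hasFDerivAt {f : X → ℝ} {f' : X →L[ℝ] ℝ}
    (hf : HasFDerivAt f f' x) (y : X) :
    Tendsto (fun t : ℝ => (f ((1 - t) • x + t • y) - f x) / t) (𝓝[>] 0) (𝓝 (f' (y - x))) := by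
  have hseg (t : ℝ) : (1 - t) • x + t • y = x + t • (y - x) := by module
  simpa only [hseg, zero_add, zero_smul, add_zero, smul_eq_mul, inv_mul_eq_div] using
    (hf.hasLineDerivAt (y - x)).tendsto_slope_zero_right

theorem fderiv_apply_sub_le_of_convexOn {f : X → ℝ} {f' : X →L[ℝ] ℝ} (hf : ConvexOn ℝ K f)
    (hf' : HasFDerivAt f f' x) (hx : x ∈ K) (hy : y ∈ K) : f' (y - x) ≤ f y - f x := by
  refine le_of_tendsto (tendsto_slope_segment_of_hasFDerivAt hf' y) ?_
  filter_upwards [Ioc_mem_nhdsGT (zero_lt_one' ℝ)] with t ht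
  have h := hf.2 hx hy (sub_nonneg.2 ht.2) ht.1.le (sub_add_cancel 1 t)
  rw [div_le_iff₀ ht.1]
  simp only [smul_eq_mul] at h
  linarith

theorem bddBelow_image_of_convexOn_of_hasFDerivAt {f : X → ℝ} {f' : X →L[ℝ] ℝ}
    (hf : ConvexOn ℝ K f) (hf' : HasFDerivAt f f' x) (hx : x ∈ K) (hK : Bornology.IsBounded K) :
    BddBelow (f '' K) := by
  refine ⟨f x - ‖f'‖ * Metric.diam K, ?_⟩
  rintro _ ⟨y, hy, rfl⟩
  have hgrad := fderiv_apply_sub_le_of_convexOn hf hf' hx hy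
  have hdiam : ‖f' (y - x)‖ ≤ ‖f'‖ * Metric.diam K := by
    refine f'.le_opNorm_of_le ?_
    simpa only [dist_eq_norm] using Metric.dist_le_diam_of_mem hK hy hx
  linarith [neg_le_of_abs_le hdiam]

theorem isMinOn_add_iff_isMinOn_fderiv_add {f φ : X → ℝ} {f' : X →L[ℝ] ℝ}
    (hf : ConvexOn ℝ K f) (hf' : HasFDerivAt f f' x) (hφ : ConvexOn ℝ K φ) (hx : x ∈ K) :
    IsMinOn (f + φ) K x ↔ IsMinOn (⇑f' + φ) K x := by
  refine ⟨fun hmin y hy => ?_, fun hmin y hy => ?_⟩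
  · suffices φ x - φ y ≤ f' (y - x) by
      simp only [Set.mem_ofPred_eq, Pi.add_apply]
      linarith [map_sub f' y x]
    refine ge_of_tendsto (tendsto_slope_segment_of_hasFDerivAt hf' y) ?_
    filter_upwards [Ioc_mem_nhdsGT (zero_lt_one' ℝ)] with t ht
    have hmin_t := hmin (hφ.1 hx hy (sub_nonneg.2 ht.2) ht.1.le (sub_add_cancel 1 t))
    have hφ_t := hφ.2 hx hy (sub_nonneg.2 ht.2) ht.1.le (sub_add_cancel 1 t)
    rw [le_div_iff₀ ht.1]
    simp only [Set.mem_ofPred_eq, Pi.add_apply, smul_eq_mul] at hmin_t hφ_t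
    linarith
  · have hlin := hmin hy
    have hgrad := fderiv_apply_sub_le_of_convexOn hf hf' hx hy
    simp only [Set.mem_ofPred_eq, Pi.add_apply, map_sub] at hlin hgrad ⊢
    linarith

theorem norm_sub_sq_le_of_strongConvexOn {J : X → ℝ} {m c ε : ℝ} (hJ : StrongConvexOn K m J)
    (hc : ∀ z ∈ K, c ≤ J z) (hx : x ∈ K) (hy : y ∈ K) (hJx : J x ≤ c + ε) (hJy : J y ≤ c + ε) :
    m / 8 * ‖x - y‖ ^ 2 ≤ ε := by
  have half_pos : (0 : ℝ) ≤ 1 / 2 := by norm_num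
  have hmid := hJ.2 hx hy half_pos half_pos (add_halves 1)
  have hc_mid := hc _ (hJ.1 hx hy half_pos half_pos (add_halves 1))
  simp only [smul_eq_mul] at hmid
  linarith

theorem existsUnique_isMinOn_of_strongConvexOn [CompleteSpace X] {J : X → ℝ} {m : ℝ}
    (hJ : StrongConvexOn K m J) (hm : 0 < m) (hne : K.Nonempty) (hbdd : BddBelow (J '' K))
    (hclosed : ∀ c, IsClosed {x ∈ K | J x ≤ c}) : ∃! x, x ∈ K ∧ IsMinOn J K x := by
  refine existsUnique_of_exists_of_unique ?_ fun x y hx hy =>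
    (hJ.strictConvexOn hm).eq_of_isMinOn hx.2 hy.2 hx.1 hy.1
  set c := sInf (J '' K)
  have hc : ∀ z ∈ K, c ≤ J z := fun z hz => csInf_le hbdd ⟨z, hz, rfl⟩
  let S : ℕ → Set X := fun n => {z ∈ K | J z ≤ c + 1 / ((n : ℝ) + 1)}
  have hanti : Antitone S := fun n k hnk z hz =>
    ⟨hz.1, hz.2.trans (add_le_add_right (Nat.one_div_le_one_div hnk) c)⟩
  have hSne (n : ℕ) : (S n).Nonempty := by
    obtain ⟨_, ⟨z, hz, rfl⟩, hlt⟩ := exists_lt_of_csInf_lt (hne.image J)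
      (lt_add_of_pos_right c (Nat.one_div_pos_of_nat (α := ℝ) (n := n)))
    exact ⟨z, hz, hlt.le⟩
  have hdist (n : ℕ) : ∀ z ∈ S n, ∀ z' ∈ S n, dist z z' ≤ √(1 / ((n : ℝ) + 1) * (m / 8)⁻¹) := by
    intro z hz z' hz'
    rw [dist_eq_norm, ← div_eq_mul_inv]
    refine Real.le_sqrt_of_sq_le ((le_div_iff₀' (by positivity)).2 ?_)
    exact norm_sub_sq_le_of_strongConvexOn hJ hc hz.1 hz'.1 hz.2 hz'.2
  have hdiam : Tendsto (fun n => Metric.diam (S n)) atTop (𝓝 0) := by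
    have hlim : Tendsto (fun n : ℕ => √(1 / ((n : ℝ) + 1) * (m / 8)⁻¹)) atTop (𝓝 0) := by
      simpa using ((tendsto_one_div_add_atTop_nhds_zero_nat (𝕜 := ℝ)).mul_const (m / 8)⁻¹).sqrt
    exact squeeze_zero (fun _ => Metric.diam_nonneg)
      (fun n => Metric.diam_le_of_forall_dist_le (Real.sqrt_nonneg _) (hdist n)) hlim
  obtain ⟨x, hx⟩ := Metric.nonempty_iInter_of_nonempty_biInter (fun n => hclosed _)
    (fun n => Metric.isBounded_iff.2 ⟨_, fun z hz z' hz' => hdist n z hz z' hz'⟩)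
    (fun N => (hSne N).mono (Set.subset_iInter₂ fun n hn => hanti hn)) hdiam
  have hxS (n : ℕ) : x ∈ S n := Set.mem_iInter.1 hx n
  have hJx : J x ≤ c := by
    refine ge_of_tendsto' (f := fun n : ℕ => c + 1 / ((n : ℝ) + 1)) (x := atTop) ?_
      fun n => (hxS n).2
    simpa using (tendsto_one_div_add_atTop_nhds_zero_nat (𝕜 := ℝ)).const_add c
  exact ⟨x, (hxS 0).1, fun y hy => hJx.trans (hc y hy)⟩

end ConvexAnalysis

section KLPerspective

theorem strongConvexOn_klFun {b : ℝ} : StrongConvexOn (Set.Icc 0 b) b⁻¹ klFun := by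
  rw [strongConvexOn_iff_convex]
  refine convexOn_of_hasDerivWithinAt2_nonneg (convex_Icc 0 b)
    (f' := fun x => Real.log x - b⁻¹ * x) (f'' := fun x => x⁻¹ - b⁻¹) ?_ ?_ ?_ ?_
  · exact (continuous_klFun.sub (by fun_prop)).continuousOn
  · intro x hx
    rw [interior_Icc] at hx
    simp only [Real.norm_eq_abs, sq_abs]
    exact ((hasDerivAt_klFun hx.1.ne').sub (((hasDerivAt_pow 2 x).const_mul (b⁻¹ / 2)).congr_deriv
      (by push_cast; ring))).hasDerivWithinAt
  · intro x hx
    rw [interior_Icc] at hx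
    exact ((Real.hasDerivAt_log hx.1.ne').sub
      (((hasDerivAt_id x).const_mul b⁻¹).congr_deriv (mul_one _))).hasDerivWithinAt
  · intro x hx
    rw [interior_Icc] at hx
    exact sub_nonneg.2 (inv_anti₀ hx.1 hx.2.le)

/-- The perspective `v * klFun (s / v) = s log (s / v) + v - s` of `klFun`: the contribution of
a point to the entropy of a density with value `s` relative to one with value `v`. -/
noncomputable def klPerspective (s v : ℝ) : ℝ := v * klFun (s / v)

variable {s t v : ℝ}

theorem klPerspective_nonneg (hs : 0 ≤ s) (hv : 0 ≤ v) : 0 ≤ klPerspective s v :=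
  mul_nonneg hv (klFun_nonneg (div_nonneg hs hv))

theorem klPerspective_eq_zero_iff (hs : 0 ≤ s) (hv : 0 < v) : klPerspective s v = 0 ↔ s = v := by
  rw [klPerspective, mul_eq_zero_iff_left hv.ne', klFun_eq_zero_iff (div_nonneg hs hv.le),
    div_eq_one_iff_eq hv.ne']

theorem klPerspective_mul_exp (s : ℝ) (hv : v ≠ 0) (c : ℝ) :
    klPerspective s (v * Real.exp c) = klPerspective s v - c * s + (v * Real.exp c - v) := by
  have hexp := Real.exp_ne_zero c
  rcases eq_or_ne s 0 with rfl | hs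
  · simp [klPerspective, klFun_zero]
  · have hlog : Real.log (s / (v * Real.exp c)) = Real.log (s / v) - c := by
      rw [← div_div, Real.log_div (div_ne_zero hs hv) hexp, Real.log_exp]
    simp only [klPerspective, klFun_apply, hlog]
    field_simp
    ring

theorem continuous_klPerspective_left (v : ℝ) : Continuous (klPerspective · v) :=
  continuous_const.mul (continuous_klFun.comp (continuous_id.div_const v))

theorem measurable_klPerspective : Measurable fun p : ℝ × ℝ => klPerspective p.1 p.2 :=
  measurable_snd.mul (measurable_klFun.comp (measurable_fst.div measurable_snd))

theorem klPerspective_add_le {a b : ℝ} (hs : 0 ≤ s) (ht : 0 ≤ t) (hv : 0 < v) (ha : 0 ≤ a)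
    (hb : 0 ≤ b) (hab : a + b = 1) :
    klPerspective (a * s + b * t) v ≤ a * klPerspective s v + b * klPerspective t v
      - a * b / 2 * ((s - t) ^ 2 / (s + t)) := by
  have hsv := div_nonneg hs hv.le
  have htv := div_nonneg ht hv.le
  have hconv := (strongConvexOn_klFun (b := s / v + t / v)).2
    ⟨hsv, le_add_of_nonneg_right htv⟩ ⟨htv, le_add_of_nonneg_left hsv⟩ ha hb hab
  simp only [smul_eq_mul, Real.norm_eq_abs, sq_abs] at hconv
  have hcombo : (a * s + b * t) / v = a * (s / v) + b * (t / v) := by ring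
  have hsq : v * ((s / v + t / v)⁻¹ * (s / v - t / v) ^ 2) = (s - t) ^ 2 / (s + t) := by
    rw [← add_div, ← sub_div, inv_div]
    field_simp
  simp only [klPerspective, hcombo, ← hsq]
  linarith [mul_le_mul_of_nonneg_left hconv hv.le]

theorem two_mul_abs_sub_sub_sq_mul_le (hs : 0 ≤ s) (ht : 0 ≤ t) (c : ℝ) :
    2 * c * |s - t| - c ^ 2 * (s + t) ≤ (s - t) ^ 2 / (s + t) := by
  rcases (add_nonneg hs ht).eq_or_lt with h0 | hpos
  · obtain ⟨rfl, rfl⟩ := (add_eq_zero_iff_of_nonneg hs ht).1 h0.symm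
    simp
  · rw [le_div_iff₀ hpos, ← sq_abs (s - t)]
    linarith [sq_nonneg (|s - t| - c * (s + t))]

end KLPerspective

section Densities

variable {α : Type*} [MeasurableSpace α] {μ : Measure α}

theorem lowerSemicontinuous_lintegral_comp_Lp {E : Type*} [NormedAddCommGroup E] {p : ℝ≥0∞}
    [Fact (1 ≤ p)] {F : α → E → ℝ≥0∞} (hF : ∀ x, LowerSemicontinuous (F x))
    (hFm : ∀ f : Lp E p μ, AEMeasurable (fun x => F x (f x)) μ) :
    LowerSemicontinuous fun f : Lp E p μ => ∫⁻ x, F x (f x) ∂μ := by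
  refine lowerSemicontinuous_iff_isClosed_preimage.2 fun c => IsSeqClosed.isClosed ?_
  intro u f hu hlim
  obtain ⟨ns, -, hae⟩ := (tendstoInMeasure_of_tendsto_Lp hlim).exists_seq_tendsto_ae
  calc ∫⁻ x, F x (f x) ∂μ
      ≤ ∫⁻ x, liminf (fun n => F x (u (ns n) x)) atTop ∂μ := by
        refine lintegral_mono_ae ?_
        filter_upwards [hae] with x hx
        exact ((hF x).le_liminf _).trans (liminf_le_liminf_of_le hx)
    _ ≤ liminf (fun n => ∫⁻ x, F x (u (ns n) x) ∂μ) atTop :=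
        lintegral_liminf_le' fun n => hFm _
    _ ≤ liminf (fun _ : ℕ => c) atTop := liminf_le_liminf (.of_forall fun n => hu (ns n))
    _ = c := liminf_const c

/-- The probability densities with respect to `μ`, as a subset of `L¹`. For the Lebesgue measure
on `Param d` this is `densities d`, by definition. -/
def probDensities (μ : Measure α) : Set (Lp ℝ 1 μ) :=
  {ρ | (∀ᵐ x ∂μ, 0 ≤ ρ x) ∧ ∫ x, ρ x ∂μ = 1}

theorem isClosed_probDensities : IsClosed (probDensities μ) := by
  have h_inter : probDensities μ = Set.Ici 0 ∩ {ρ : Lp ℝ 1 μ | ∫ x, ρ x ∂μ = 1} := by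
    ext ρ
    exact and_congr_left' (Lp.coeFn_nonneg ρ)
  rw [h_inter]
  exact isClosed_Ici.inter (isClosed_eq continuous_integral continuous_const)

theorem coeFn_smul_add_smul (a b : ℝ) (ρ σ : Lp ℝ 1 μ) :
    ⇑(a • ρ + b • σ) =ᵐ[μ] fun x => a * ρ x + b * σ x := by
  filter_upwards [Lp.coeFn_add (a • ρ) (b • σ), Lp.coeFn_smul a ρ, Lp.coeFn_smul b σ]
    with x hadd hρ hσ
  rw [hadd, Pi.add_apply, hρ, hσ, Pi.smul_apply, Pi.smul_apply, smul_eq_mul, smul_eq_mul]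

theorem convex_probDensities : Convex ℝ (probDensities μ) := by
  intro ρ hρ σ hσ a b ha hb hab
  have hcombo := coeFn_smul_add_smul a b ρ σ
  constructor
  · filter_upwards [hcombo, hρ.1, hσ.1] with x hx hρx hσx
    rw [hx]
    positivity
  · rw [integral_congr_ae hcombo, integral_add ((L1.integrable_coeFn ρ).const_mul a)
      ((L1.integrable_coeFn σ).const_mul b), integral_const_mul, integral_const_mul, hρ.2, hσ.2,
      mul_one, mul_one, hab]

theorem isBounded_probDensities : Bornology.IsBounded (probDensities μ) := by
  refine isBounded_iff_forall_norm_le.2 ⟨1, fun ρ hρ => le_of_eq ?_⟩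
  rw [L1.norm_eq_integral_norm, ← hρ.2]
  refine integral_congr_ae ?_
  filter_upwards [hρ.1] with x hx using Real.norm_of_nonneg hx

/-- The entropy `∫ ρ log (ρ / w) + w - ρ` of `ρ` relative to the weight `w`. It is a junk value,
`0`, when the integral diverges, which `finiteEntropyDensities` excludes. -/
noncomputable def relEntropy (μ : Measure α) (w : α → ℝ) (ρ : Lp ℝ 1 μ) : ℝ :=
  ∫ x, klPerspective (ρ x) (w x) ∂μ

/-- The probability densities whose entropy relative to the weight `w` is finite. -/
def finiteEntropyDensities (μ : Measure α) (w : α → ℝ) : Set (Lp ℝ 1 μ) :=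
  {ρ ∈ probDensities μ | Integrable (fun x => klPerspective (ρ x) (w x)) μ}

variable {w : α → ℝ}

theorem aemeasurable_klPerspective_comp (hw : AEMeasurable w μ) (ρ : Lp ℝ 1 μ) :
    AEMeasurable (fun x => klPerspective (ρ x) (w x)) μ :=
  measurable_klPerspective.comp_aemeasurable ((Lp.aestronglyMeasurable ρ).aemeasurable.prodMk hw)

theorem ae_klPerspective_nonneg (hw : ∀ x, 0 < w x) {ρ : Lp ℝ 1 μ} (hρ : ρ ∈ probDensities μ) :
    ∀ᵐ x ∂μ, 0 ≤ klPerspective (ρ x) (w x) := by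
  filter_upwards [hρ.1] with x hx using klPerspective_nonneg hx (hw x).le

theorem relEntropy_nonneg (hw : ∀ x, 0 < w x) {ρ : Lp ℝ 1 μ} (hρ : ρ ∈ probDensities μ) :
    0 ≤ relEntropy μ w ρ :=
  integral_nonneg_of_ae (ae_klPerspective_nonneg hw hρ)

theorem mem_finiteEntropyDensities_and_relEntropy_le_iff (hw : ∀ x, 0 < w x)
    (hwm : AEMeasurable w μ) {ρ : Lp ℝ 1 μ} (hρ : ρ ∈ probDensities μ) (c : ℝ) :
    ρ ∈ finiteEntropyDensities μ w ∧ relEntropy μ w ρ ≤ c ↔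
      ∫⁻ x, ENNReal.ofReal (klPerspective (ρ x) (w x)) ∂μ ≤ ENNReal.ofReal c ∧ 0 ≤ c := by
  have hnonneg := ae_klPerspective_nonneg hw hρ
  refine ⟨fun ⟨hρK, hle⟩ => ⟨?_, (relEntropy_nonneg hw hρ).trans hle⟩, fun ⟨hle, hc⟩ => ?_⟩
  · rw [← ofReal_integral_eq_lintegral_ofReal hρK.2 hnonneg]
    exact ENNReal.ofReal_le_ofReal hle
  · have hint : Integrable (fun x => klPerspective (ρ x) (w x)) μ :=
      ⟨(aemeasurable_klPerspective_comp hwm ρ).aestronglyMeasurable,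
        (hasFiniteIntegral_iff_ofReal hnonneg).2 (hle.trans_lt ENNReal.ofReal_lt_top)⟩
    rw [← ofReal_integral_eq_lintegral_ofReal hint hnonneg, ENNReal.ofReal_le_ofReal_iff hc] at hle
    exact ⟨⟨hρ, hint⟩, hle⟩

theorem integral_abs_sub_eq_norm_sub (ρ σ : Lp ℝ 1 μ) :
    ∫ x, |ρ x - σ x| ∂μ = ‖ρ - σ‖ := by
  rw [L1.norm_eq_integral_norm]
  refine integral_congr_ae ?_
  filter_upwards [Lp.coeFn_sub ρ σ] with x hx
  rw [hx, Pi.sub_apply, Real.norm_eq_abs]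

theorem ae_klPerspective_combo_le (hw : ∀ x, 0 < w x) {ρ σ : Lp ℝ 1 μ} (hρ : ρ ∈ probDensities μ)
    (hσ : σ ∈ probDensities μ) {a b : ℝ} (ha : 0 ≤ a) (hb : 0 ≤ b) (hab : a + b = 1) (c : ℝ) :
    ∀ᵐ x ∂μ, klPerspective ((a • ρ + b • σ : Lp ℝ 1 μ) x) (w x) ≤
      a * klPerspective (ρ x) (w x) + b * klPerspective (σ x) (w x)
        - a * b / 2 * (2 * c * |ρ x - σ x| - c ^ 2 * (ρ x + σ x)) := by
  filter_upwards [coeFn_smul_add_smul a b ρ σ, hρ.1, hσ.1] with x hcombo hρx hσx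
  rw [hcombo]
  have hab2 : 0 ≤ a * b / 2 := by positivity
  linarith [klPerspective_add_le hρx hσx (hw x) ha hb hab,
    mul_le_mul_of_nonneg_left (two_mul_abs_sub_sub_sq_mul_le hρx hσx c) hab2]

theorem convex_finiteEntropyDensities (hw : ∀ x, 0 < w x) (hwm : AEMeasurable w μ) :
    Convex ℝ (finiteEntropyDensities μ w) := by
  intro ρ hρ σ hσ a b ha hb hab
  have hmem := convex_probDensities hρ.1 hσ.1 ha hb hab
  refine ⟨hmem, Integrable.mono' ((hρ.2.const_mul a).add (hσ.2.const_mul b))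
    (aemeasurable_klPerspective_comp hwm _).aestronglyMeasurable ?_⟩
  filter_upwards [ae_klPerspective_nonneg hw hmem,
    ae_klPerspective_combo_le hw hρ.1 hσ.1 ha hb hab 0] with x hnonneg hle
  rw [Real.norm_of_nonneg hnonneg]
  simpa using hle

theorem strongConvexOn_relEntropy (hw : ∀ x, 0 < w x) (hwm : AEMeasurable w μ) :
    StrongConvexOn (finiteEntropyDensities μ w) (1 / 2) (relEntropy μ w) := by
  refine ⟨convex_finiteEntropyDensities hw hwm, fun ρ hρ σ hσ a b ha hb hab => ?_⟩
  have hcombo := convex_finiteEntropyDensities hw hwm hρ hσ ha hb hab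
  have hρ_int := L1.integrable_coeFn ρ
  have hσ_int := L1.integrable_coeFn σ
  have habs_int : Integrable (fun x => |ρ x - σ x|) μ := (hρ_int.sub hσ_int).abs
  have hsum_int : Integrable (fun x => ρ x + σ x) μ := hρ_int.add hσ_int
  have hsum : ∫ x, (ρ x + σ x) ∂μ = 2 := by
    rw [integral_add hρ_int hσ_int, hρ.1.2, hσ.1.2, one_add_one_eq_two]
  have hconv_int : Integrable (fun x =>
      a * klPerspective (ρ x) (w x) + b * klPerspective (σ x) (w x)) μ :=
    (hρ.2.const_mul a).add (hσ.2.const_mul b)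
  -- The choice `c = D / 2` maximizes `2 c D - 2 c ^ 2`, where `D` is the distance.
  set c := ‖ρ - σ‖ / 2 with hc
  have hgap_int : Integrable (fun x =>
      a * b / 2 * (2 * c * |ρ x - σ x| - c ^ 2 * (ρ x + σ x))) μ :=
    ((habs_int.const_mul _).sub (hsum_int.const_mul _)).const_mul _
  calc relEntropy μ w (a • ρ + b • σ)
      ≤ ∫ x, (a * klPerspective (ρ x) (w x) + b * klPerspective (σ x) (w x)
          - a * b / 2 * (2 * c * |ρ x - σ x| - c ^ 2 * (ρ x + σ x))) ∂μ :=
        integral_mono_ae hcombo.2 (hconv_int.sub hgap_int)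
          (ae_klPerspective_combo_le hw hρ.1 hσ.1 ha hb hab c)
    _ = a * relEntropy μ w ρ + b * relEntropy μ w σ
          - a * b / 2 * (2 * c * ‖ρ - σ‖ - c ^ 2 * 2) := by
        rw [integral_sub hconv_int hgap_int, integral_add (hρ.2.const_mul a) (hσ.2.const_mul b),
          integral_const_mul, integral_const_mul, integral_const_mul,
          integral_sub (habs_int.const_mul _) (hsum_int.const_mul _),
          integral_const_mul, integral_const_mul, hsum, integral_abs_sub_eq_norm_sub]
        rfl
    _ = a • relEntropy μ w ρ + b • relEntropy μ w σ - a * b * (1 / 2 / 2 * ‖ρ - σ‖ ^ 2) := by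
        simp only [smul_eq_mul, hc]
        ring

/-- The free energy of an energy `φ` on `L¹`: the sum of `φ` and of the entropy relative to the
weight `w`. -/
noncomputable def freeEnergy (μ : Measure α) (w : α → ℝ) (φ : Lp ℝ 1 μ → ℝ) (ρ : Lp ℝ 1 μ) : ℝ :=
  φ ρ + relEntropy μ w ρ

theorem isClosed_setOf_freeEnergy_le (hw : ∀ x, 0 < w x) (hwm : AEMeasurable w μ)
    {φ : Lp ℝ 1 μ → ℝ} (hφ : ContinuousOn φ (probDensities μ)) (c : ℝ) :
    IsClosed {ρ ∈ finiteEntropyDensities μ w | freeEnergy μ w φ ρ ≤ c} := by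
  have hlsc : LowerSemicontinuous fun ρ : Lp ℝ 1 μ =>
      ∫⁻ x, ENNReal.ofReal (klPerspective (ρ x) (w x)) ∂μ :=
    lowerSemicontinuous_lintegral_comp_Lp (F := fun x s => ENNReal.ofReal (klPerspective s (w x)))
      (fun x => (ENNReal.continuous_ofReal.comp
        (continuous_klPerspective_left (w x))).lowerSemicontinuous)
      fun ρ => (aemeasurable_klPerspective_comp hwm ρ).ennreal_ofReal
  have hclosed : IsClosed {p : Lp ℝ 1 μ × ℝ |
      ∫⁻ x, ENNReal.ofReal (klPerspective (p.1 x) (w x)) ∂μ ≤ ENNReal.ofReal p.2 ∧ 0 ≤ p.2} :=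
    (hlsc.isClosed_epigraph.preimage (continuous_id.prodMap ENNReal.continuous_ofReal)).inter
      (isClosed_Ici.preimage continuous_snd)
  have hset : {ρ ∈ finiteEntropyDensities μ w | freeEnergy μ w φ ρ ≤ c} =
      probDensities μ ∩ (fun ρ => (ρ, c - φ ρ)) ⁻¹' {p : Lp ℝ 1 μ × ℝ |
        ∫⁻ x, ENNReal.ofReal (klPerspective (p.1 x) (w x)) ∂μ ≤ ENNReal.ofReal p.2 ∧
          0 ≤ p.2} := by
    ext ρ
    constructor
    · rintro ⟨hρ, hle⟩
      exact ⟨hρ.1, (mem_finiteEntropyDensities_and_relEntropy_le_iff hw hwm hρ.1 _).1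
        ⟨hρ, le_sub_iff_add_le'.2 hle⟩⟩
    · rintro ⟨hρ, hle⟩
      obtain ⟨hρK, hle'⟩ := (mem_finiteEntropyDensities_and_relEntropy_le_iff hw hwm hρ _).2 hle
      exact ⟨hρK, le_sub_iff_add_le'.1 hle'⟩
  rw [hset]
  exact (continuousOn_id.prodMk (continuousOn_const.sub hφ)).preimage_isClosed_of_isClosed
    isClosed_probDensities hclosed

theorem strongConvexOn_freeEnergy {φ : Lp ℝ 1 μ → ℝ} (hφ : ConvexOn ℝ (probDensities μ) φ)
    (hw : ∀ x, 0 < w x) (hwm : AEMeasurable w μ) :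
    StrongConvexOn (finiteEntropyDensities μ w) (1 / 2) (freeEnergy μ w φ) := by
  have hentropy := strongConvexOn_relEntropy hw hwm
  have hφ_conv := strongConvexOn_zero.2 (hφ.subset (Set.sep_subset _ _) hentropy.1)
  have hsum : UniformConvexOn (finiteEntropyDensities μ w) _ (freeEnergy μ w φ) :=
    hφ_conv.add hentropy
  simpa only [StrongConvexOn, zero_div, zero_mul, Pi.add_def, zero_add] using hsum

end Densities

section Gradient

variable {α : Type*} [MeasurableSpace α] {μ : Measure α} {D : Lp ℝ 1 μ →L[ℝ] ℝ} {u : α → ℝ}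

/-- The functional `D` on `L¹` is integration against the function `u`. -/
def IsRepresentedBy (D : Lp ℝ 1 μ →L[ℝ] ℝ) (u : α → ℝ) : Prop :=
  ∀ h : Lp ℝ 1 μ, Integrable (fun x => u x * h x) μ ∧ D h = ∫ x, u x * h x ∂μ

theorem isRepresentedBy_zero : IsRepresentedBy (0 : Lp ℝ 1 μ →L[ℝ] ℝ) 0 := fun h => by simp

namespace IsRepresentedBy

theorem const_smul (hD : IsRepresentedBy D u) (c : ℝ) :
    IsRepresentedBy (c • D) fun x => c * u x := fun h => by
  simp only [mul_assoc, integral_const_mul, ← (hD h).2]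
  exact ⟨(hD h).1.const_mul c, rfl⟩

theorem integrable_mul (hD : IsRepresentedBy D u) {h : α → ℝ} (hh : Integrable h μ) :
    Integrable (fun x => u x * h x) μ :=
  (hD (hh.toL1 h)).1.congr (hh.coeFn_toL1.mono fun x hx => congrArg (u x * ·) hx)

theorem apply_toL1 (hD : IsRepresentedBy D u) {h : α → ℝ} (hh : Integrable h μ) :
    D (hh.toL1 h) = ∫ x, u x * h x ∂μ :=
  (hD (hh.toL1 h)).2.trans
    (integral_congr_ae (hh.coeFn_toL1.mono fun x hx => congrArg (u x * ·) hx))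

variable {w : α → ℝ}

theorem aestronglyMeasurable (hD : IsRepresentedBy D u) (hw : ∀ x, 0 < w x)
    (hwi : Integrable w μ) : AEStronglyMeasurable u μ := by
  have hdiv := ((hD.integrable_mul hwi).aemeasurable.div hwi.aemeasurable).aestronglyMeasurable
  exact hdiv.congr (.of_forall fun x => mul_div_cancel_right₀ (u x) (hw x).ne')

theorem ae_le_opNorm (hD : IsRepresentedBy D u) (hw : ∀ x, 0 < w x) (hwi : Integrable w μ) :
    ∀ᵐ x ∂μ, u x ≤ ‖D‖ := by
  have hle : (fun x => u x * w x) ≤ᵐ[μ] fun x => ‖D‖ * w x := by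
    refine ae_le_of_forall_setIntegral_le (hD.integrable_mul hwi) (hwi.const_mul ‖D‖)
      fun s hs _ => ?_
    have hsw := hwi.indicator hs
    calc ∫ x in s, u x * w x ∂μ
        = D (hsw.toL1 _) := by
          rw [hD.apply_toL1, ← integral_indicator hs]
          simp only [Set.indicator_mul_right]
      _ ≤ ‖D‖ * ‖hsw.toL1 _‖ := (le_abs_self _).trans (D.le_opNorm _)
      _ = ‖D‖ * ∫ x in s, w x ∂μ := by
          rw [L1.norm_of_fun_eq_integral_norm, ← integral_indicator hs]
          simp only [norm_indicator_eq_indicator_norm, Real.norm_of_nonneg (hw _).le]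
      _ = ∫ x in s, ‖D‖ * w x ∂μ := (integral_const_mul _ _).symm
  filter_upwards [hle] with x hx using le_of_mul_le_mul_right hx (hw x)

theorem ae_abs_le_opNorm (hD : IsRepresentedBy D u) (hw : ∀ x, 0 < w x)
    (hwi : Integrable w μ) : ∀ᵐ x ∂μ, |u x| ≤ ‖D‖ := by
  filter_upwards [hD.ae_le_opNorm hw hwi, (hD.const_smul (-1)).ae_le_opNorm hw hwi]
    with x hle hge
  simp only [neg_one_mul, norm_smul, norm_neg, norm_one, one_mul] at hge
  exact abs_le'.2 ⟨hle, hge⟩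

end IsRepresentedBy

/-- The function `f` on `L¹` is Fréchet differentiable at `ρ` and its differential there is
integration against `u`. -/
def HasL1Gradient (f : Lp ℝ 1 μ → ℝ) (u : α → ℝ) (ρ : Lp ℝ 1 μ) : Prop :=
  ∃ D : Lp ℝ 1 μ →L[ℝ] ℝ, HasFDerivAt f D ρ ∧ IsRepresentedBy D u

theorem HasL1Gradient.const_smul {f : Lp ℝ 1 μ → ℝ} {ρ : Lp ℝ 1 μ} (hf : HasL1Gradient f u ρ)
    (c : ℝ) : HasL1Gradient (c • f) (fun x => c * u x) ρ := by
  obtain ⟨D, hfD, hD⟩ := hf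
  exact ⟨c • D, hfD.const_smul c, hD.const_smul c⟩

end Gradient

section Gibbs

variable {α : Type*} [MeasurableSpace α] {μ : Measure α} {w v : α → ℝ}

/-- The Gibbs density of the potential `v` relative to the weight `w`. -/
noncomputable def gibbsDensity (μ : Measure α) (w v : α → ℝ) (x : α) : ℝ :=
  Real.exp (-v x) * w x / ∫ y, Real.exp (-v y) * w y ∂μ

theorem integral_exp_mul_pos [NeZero μ] (hw : ∀ x, 0 < w x)
    (hint : Integrable (fun x => Real.exp (-v x) * w x) μ) :
    0 < ∫ x, Real.exp (-v x) * w x ∂μ := by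
  have hexp (x : α) : Real.exp (-v x) * w x = Real.exp (-v x + Real.log (w x)) := by
    rw [Real.exp_add, Real.exp_log (hw x)]
  simp only [hexp] at hint ⊢
  exact integral_exp_pos hint

theorem relEntropy_eq_zero_iff (hw : ∀ x, 0 < w x) {ρ : Lp ℝ 1 μ}
    (hρ : ρ ∈ finiteEntropyDensities μ w) : relEntropy μ w ρ = 0 ↔ ρ =ᵐ[μ] w := by
  rw [relEntropy, integral_eq_zero_iff_of_nonneg_ae (ae_klPerspective_nonneg hw hρ.1) hρ.2]
  refine eventually_congr ?_
  filter_upwards [hρ.1.1] with x hx using klPerspective_eq_zero_iff hx (hw x)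

variable {D : Lp ℝ 1 μ →L[ℝ] ℝ}

theorem IsRepresentedBy.integrable_exp_neg_mul (hD : IsRepresentedBy D v) (hw : ∀ x, 0 < w x)
    (hwi : Integrable w μ) : Integrable (fun x => Real.exp (-v x) * w x) μ := by
  refine hwi.bdd_mul (c := Real.exp ‖D‖)
    (Real.continuous_exp.comp_aestronglyMeasurable (hD.aestronglyMeasurable hw hwi).neg) ?_
  filter_upwards [hD.ae_abs_le_opNorm hw hwi] with x hx
  rw [Real.norm_of_nonneg (Real.exp_pos _).le]
  exact Real.exp_le_exp.2 ((neg_le_abs _).trans hx)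

variable [NeZero μ]

theorem gibbsDensity_pos (hw : ∀ x, 0 < w x)
    (hint : Integrable (fun x => Real.exp (-v x) * w x) μ) (x : α) : 0 < gibbsDensity μ w v x :=
  div_pos (mul_pos (Real.exp_pos _) (hw x)) (integral_exp_mul_pos hw hint)

theorem integral_gibbsDensity (hw : ∀ x, 0 < w x)
    (hint : Integrable (fun x => Real.exp (-v x) * w x) μ) : ∫ x, gibbsDensity μ w v x ∂μ = 1 := by
  simp only [gibbsDensity, integral_div, div_self (integral_exp_mul_pos hw hint).ne']

theorem klPerspective_gibbsDensity (hw : ∀ x, 0 < w x)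
    (hint : Integrable (fun x => Real.exp (-v x) * w x) μ) (s : ℝ) (x : α) :
    klPerspective s (gibbsDensity μ w v x) = klPerspective s (w x) + v x * s
      + Real.log (∫ y, Real.exp (-v y) * w y ∂μ) * s + (gibbsDensity μ w v x - w x) := by
  set Z := ∫ y, Real.exp (-v y) * w y ∂μ
  have hgibbs : gibbsDensity μ w v x = w x * Real.exp (-v x - Real.log Z) := by
    rw [Real.exp_sub, Real.exp_log (integral_exp_mul_pos hw hint), gibbsDensity]
    ring
  rw [hgibbs, klPerspective_mul_exp s (hw x).ne']
  ring

theorem exists_mem_finiteEntropyDensities_ae_eq_gibbsDensity (hD : IsRepresentedBy D v)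
    (hw : ∀ x, 0 < w x) (hwi : Integrable w μ) :
    ∃ γ ∈ finiteEntropyDensities μ w, γ =ᵐ[μ] gibbsDensity μ w v := by
  have hint := hD.integrable_exp_neg_mul hw hwi
  have hγ : Integrable (gibbsDensity μ w v) μ := hint.div_const _
  have hcoe := hγ.coeFn_toL1
  have hnonneg : ∀ᵐ x ∂μ, 0 ≤ hγ.toL1 _ x := by
    filter_upwards [hcoe] with x hx
    exact hx ▸ (gibbsDensity_pos hw hint x).le
  refine ⟨hγ.toL1 _, ⟨⟨hnonneg, ?_⟩, ?_⟩, hcoe⟩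
  · rw [integral_congr_ae hcoe, integral_gibbsDensity hw hint]
  · refine (((hwi.sub hγ).sub (hγ.const_mul (Real.log (∫ y, Real.exp (-v y) * w y ∂μ)))).sub
      (hD.integrable_mul hγ)).congr ?_
    filter_upwards [hcoe] with x hx
    have hself := (klPerspective_eq_zero_iff (gibbsDensity_pos hw hint x).le
      (gibbsDensity_pos hw hint x)).2 rfl
    rw [klPerspective_gibbsDensity hw hint] at hself
    simp only [Pi.sub_apply, hx]
    linarith

theorem relEntropy_gibbsDensity (hD : IsRepresentedBy D v) (hw : ∀ x, 0 < w x)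
    (hwi : Integrable w μ) {ρ : Lp ℝ 1 μ} (hρ : ρ ∈ finiteEntropyDensities μ w) :
    ρ ∈ finiteEntropyDensities μ (gibbsDensity μ w v) ∧
      relEntropy μ (gibbsDensity μ w v) ρ = freeEnergy μ w D ρ
        + (Real.log (∫ x, Real.exp (-v x) * w x ∂μ) + 1 - ∫ x, w x ∂μ) := by
  have hint := hD.integrable_exp_neg_mul hw hwi
  have hγ : Integrable (gibbsDensity μ w v) μ := hint.div_const _
  set Z := ∫ x, Real.exp (-v x) * w x ∂μ
  have hlin : Integrable (fun x => klPerspective (ρ x) (w x) + v x * ρ x) μ := hρ.2.add (hD ρ).1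
  have hlog : Integrable (fun x => Real.log Z * ρ x) μ := (L1.integrable_coeFn ρ).const_mul _
  have hsum : Integrable (fun x => klPerspective (ρ x) (w x) + v x * ρ x + Real.log Z * ρ x) μ :=
    hlin.add hlog
  have hdiff : Integrable (fun x => gibbsDensity μ w v x - w x) μ := hγ.sub hwi
  simp only [finiteEntropyDensities, freeEnergy, relEntropy, Set.mem_ofPred_eq,
    klPerspective_gibbsDensity hw hint]
  refine ⟨⟨hρ.1, hsum.add hdiff⟩, ?_⟩
  rw [integral_add hsum hdiff, integral_add hlin hlog, integral_add hρ.2 (hD ρ).1,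
    integral_sub hγ hwi, integral_const_mul, hρ.1.2, integral_gibbsDensity hw hint, (hD ρ).2]
  ring

theorem isMinOn_freeEnergy_clm_iff_ae_eq_gibbsDensity (hD : IsRepresentedBy D v)
    (hw : ∀ x, 0 < w x) (hwi : Integrable w μ) {ρ : Lp ℝ 1 μ}
    (hρ : ρ ∈ finiteEntropyDensities μ w) :
    IsMinOn (freeEnergy μ w D) (finiteEntropyDensities μ w) ρ ↔
      ρ =ᵐ[μ] gibbsDensity μ w v := by
  have hpos := gibbsDensity_pos hw (hD.integrable_exp_neg_mul hw hwi)
  obtain ⟨hρ_fin, hρ_eq⟩ := relEntropy_gibbsDensity hD hw hwi hρ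
  rw [← relEntropy_eq_zero_iff hpos hρ_fin]
  refine ⟨fun hmin => ?_, fun hzero σ hσ => ?_⟩
  · obtain ⟨γ, hγ, hγ_ae⟩ := exists_mem_finiteEntropyDensities_ae_eq_gibbsDensity hD hw hwi
    obtain ⟨hγ_fin, hγ_eq⟩ := relEntropy_gibbsDensity hD hw hwi hγ
    have hγ_zero := (relEntropy_eq_zero_iff hpos hγ_fin).2 hγ_ae
    have hle : freeEnergy μ w D ρ ≤ freeEnergy μ w D γ := hmin hγ
    linarith [relEntropy_nonneg hpos hρ.1]
  · obtain ⟨-, hσ_eq⟩ := relEntropy_gibbsDensity hD hw hwi hσ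
    suffices freeEnergy μ w D ρ ≤ freeEnergy μ w D σ from this
    linarith [relEntropy_nonneg hpos hσ.1]

end Gibbs

section FreeEnergy

variable {α : Type*} [MeasurableSpace α] {μ : Measure α} [NeZero μ] {w : α → ℝ}
  {φ : Lp ℝ 1 μ → ℝ} {v : Lp ℝ 1 μ → α → ℝ}

theorem isMinOn_freeEnergy_iff_ae_eq_gibbsDensity (hφ : ConvexOn ℝ (probDensities μ) φ)
    {u : α → ℝ} {ρ : Lp ℝ 1 μ} (hu : HasL1Gradient φ u ρ) (hw : ∀ x, 0 < w x)
    (hwi : Integrable w μ) :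
    (ρ ∈ finiteEntropyDensities μ w ∧
      IsMinOn (freeEnergy μ w φ) (finiteEntropyDensities μ w) ρ) ↔
      ρ =ᵐ[μ] gibbsDensity μ w u := by
  obtain ⟨D, hφD, hD⟩ := hu
  have hconv := strongConvexOn_relEntropy hw hwi.aemeasurable
  have hiff (hρ : ρ ∈ finiteEntropyDensities μ w) :
      IsMinOn (freeEnergy μ w φ) (finiteEntropyDensities μ w) ρ ↔
        ρ =ᵐ[μ] gibbsDensity μ w u :=
    (isMinOn_add_iff_isMinOn_fderiv_add (hφ.subset (Set.sep_subset _ _) hconv.1) hφD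
      (hconv.strictConvexOn one_half_pos).convexOn hρ).trans
      (isMinOn_freeEnergy_clm_iff_ae_eq_gibbsDensity hD hw hwi hρ)
  refine ⟨fun ⟨hρ, hmin⟩ => (hiff hρ).1 hmin, fun hρ => ?_⟩
  obtain ⟨γ, hγ, hγ_ae⟩ := exists_mem_finiteEntropyDensities_ae_eq_gibbsDensity hD hw hwi
  obtain rfl : ρ = γ := Lp.ext (hρ.trans hγ_ae.symm)
  exact ⟨hγ, (hiff hγ).2 hρ⟩

theorem existsUnique_isMinOn_freeEnergy (hφ : ConvexOn ℝ (probDensities μ) φ)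
    (hv : ∀ ρ ∈ probDensities μ, HasL1Gradient φ (v ρ) ρ) (hw : ∀ x, 0 < w x)
    (hwi : Integrable w μ) :
    ∃! ρ, ρ ∈ finiteEntropyDensities μ w ∧
      IsMinOn (freeEnergy μ w φ) (finiteEntropyDensities μ w) ρ := by
  have hsub : finiteEntropyDensities μ w ⊆ probDensities μ := Set.sep_subset _ _
  obtain ⟨γ, hγ, -⟩ :=
    exists_mem_finiteEntropyDensities_ae_eq_gibbsDensity isRepresentedBy_zero hw hwi
  refine existsUnique_isMinOn_of_strongConvexOn
    (strongConvexOn_freeEnergy hφ hw hwi.aemeasurable) one_half_pos ⟨γ, hγ⟩ ?_ ?_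
  · obtain ⟨D, hφD, -⟩ := hv γ hγ.1
    obtain ⟨c, hc⟩ :=
      bddBelow_image_of_convexOn_of_hasFDerivAt hφ hφD hγ.1 isBounded_probDensities
    refine ⟨c, ?_⟩
    rintro _ ⟨ρ, hρ, rfl⟩
    exact (hc ⟨ρ, hsub hρ, rfl⟩).trans (le_add_of_nonneg_right (relEntropy_nonneg hw hρ.1))
  · refine isClosed_setOf_freeEnergy_le hw hwi.aemeasurable fun ρ hρ => ?_
    obtain ⟨D, hφD, -⟩ := hv ρ hρ
    exact hφD.continuousAt.continuousWithinAt

end FreeEnergy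

section Risk

variable {d : ℕ} {E : Type*} [NormedAddCommGroup E] [InnerProductSpace ℝ E] {R : E → ℝ}
  {Ψ : Param d → E}

theorem convexOn_risk (hR : ConvexOn ℝ Set.univ R) (hΨ : PairingDefined Ψ) :
    ConvexOn ℝ Set.univ (risk R Ψ) :=
  hR.comp_linearMap (pairingLin hΨ)

theorem hasL1Gradient_risk [CompleteSpace E] (hR : Differentiable ℝ R) (hΨ : PairingDefined Ψ)
    (ρ : L1 d) : HasL1Gradient (risk R Ψ) (riskDeriv R Ψ ρ) ρ := by
  obtain ⟨D, hD, hD_eq⟩ := hasFDerivAt_risk hR hΨ ρ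
  refine ⟨D, hD, fun h => ⟨?_, hD_eq h⟩⟩
  simpa [riskDeriv, mul_comm] using (fderiv ℝ R (pairing Ψ ρ)).integrable_comp (hΨ h)

end Risk

end MeanField

open MeanField in
theorem proposition2_general {α : Type*} [MeasurableSpace α] {μ : Measure α} [NeZero μ]
    {f : Lp ℝ 1 μ → ℝ} (hf : ConvexOn ℝ (probDensities μ) f) {f' : Lp ℝ 1 μ → α → ℝ}
    (hf' : ∀ ρ ∈ probDensities μ, HasL1Gradient f (f' ρ) ρ) {g : α → ℝ} {β : ℝ} (hβ : 0 ≤ β)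
    (hg : Integrable (fun x => Real.exp (-β * g x)) μ) :
    (∀ ρ ∈ probDensities μ, Integrable (fun x => Real.exp (-β * (f' ρ x + g x))) μ ∧
      0 < ∫ x, Real.exp (-β * (f' ρ x + g x)) ∂μ) ∧
    ∃ T : probDensities μ → probDensities μ,
      (∀ ρ : probDensities μ, (T ρ : Lp ℝ 1 μ) =ᵐ[μ] fun x =>
        Real.exp (-β * (f' ρ x + g x)) / ∫ y, Real.exp (-β * (f' ρ y + g y)) ∂μ) ∧
      ∃! ρ, Function.IsFixedPt T ρ := by
  set w : α → ℝ := fun x => Real.exp (-β * g x)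
  have hw (x : α) : 0 < w x := Real.exp_pos _
  have hφ : ConvexOn ℝ (probDensities μ) (β • f) := hf.smul hβ
  have hφ' (ρ : Lp ℝ 1 μ) (hρ : ρ ∈ probDensities μ) :
      HasL1Gradient (β • f) (fun x => β * f' ρ x) ρ := (hf' ρ hρ).const_smul β
  have hexp (ρ : Lp ℝ 1 μ) (x : α) :
      Real.exp (-β * (f' ρ x + g x)) = Real.exp (-(β * f' ρ x)) * w x := by
    rw [mul_add, Real.exp_add, neg_mul]
  simp only [hexp]
  obtain ⟨ρ, ⟨hρ, hρ_min⟩, hρ_unique⟩ := existsUnique_isMinOn_freeEnergy hφ hφ' hw hg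
  have hgibbs (σ : probDensities μ) : ∃ τ : probDensities μ,
      τ.1 =ᵐ[μ] gibbsDensity μ w fun x => β * f' σ x := by
    obtain ⟨D, -, hD⟩ := hφ' σ σ.2
    obtain ⟨τ, hτ, hτ_ae⟩ := exists_mem_finiteEntropyDensities_ae_eq_gibbsDensity hD hw hg
    exact ⟨⟨τ, hτ.1⟩, hτ_ae⟩
  choose T hT using hgibbs
  have hfix (σ : probDensities μ) : Function.IsFixedPt T σ ↔
      σ.1 ∈ finiteEntropyDensities μ w ∧
        IsMinOn (freeEnergy μ w (β • f)) (finiteEntropyDensities μ w) σ := by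
    rw [isMinOn_freeEnergy_iff_ae_eq_gibbsDensity hφ (hφ' σ σ.2) hw hg, Function.IsFixedPt,
      Subtype.ext_iff, Lp.ext_iff]
    exact ⟨fun h => h.symm.trans (hT σ), fun h => (hT σ).trans h.symm⟩
  refine ⟨fun σ hσ => ?_, T, hT, ⟨ρ, hρ.1⟩, (hfix _).2 ⟨hρ, hρ_min⟩,
    fun σ hσ => Subtype.ext (hρ_unique σ ((hfix σ).1 hσ))⟩
  obtain ⟨D, -, hD⟩ := hφ' σ hσ
  have hint := hD.integrable_exp_neg_mul hw hg
  exact ⟨hint, integral_exp_mul_pos hw hint⟩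

theorem proposition2 {d : ℕ} {E : Type*} [NormedAddCommGroup E] [InnerProductSpace ℝ E]
    [CompleteSpace E]
    -- the risk functional is nonnegative, convex and Fréchet differentiable
    (R : E → ℝ) (hR_nonneg : ∀ x, 0 ≤ R x) (hR_convex : ConvexOn ℝ Set.univ R)
    (hR_diff : Differentiable ℝ R)
    -- the feature map, for which `F₀` is defined on `L¹`
    (Ψ : MeanField.Param d → E) (hΨ : MeanField.PairingDefined Ψ)
    -- the differentials of `F₀` on the unit ball of `L¹`
    (h_equicont : Set.UniformEquicontinuous
      {f : MeanField.Param d → ℝ | ∃ ρ : MeanField.L1 d, ‖ρ‖ ≤ 1 ∧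
        f = MeanField.riskDeriv R Ψ ρ})
    (h_bdd : ∃ M : ℝ, ∀ ρ : MeanField.L1 d, ‖ρ‖ ≤ 1 →
      ∀ θ, |MeanField.riskDeriv R Ψ ρ θ| ≤ M)
    -- the regularizer
    (g : MeanField.Param d → ℝ) (hg_nonneg : ∀ θ, 0 ≤ g θ) (hg_diff : Differentiable ℝ g)
    (hg_conf : MeanField.IsConfining g)
    (β : ℝ) (hβ : 0 < β) :
    (∀ ρ ∈ MeanField.densities d,
      Integrable (MeanField.boltzmannWeight R Ψ g β ρ) ∧
        0 < MeanField.partitionFn R Ψ g β ρ) ∧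
    ∃ T : MeanField.densities d → MeanField.densities d,
      (∀ ρ : MeanField.densities d,
        ((T ρ : MeanField.L1 d) : MeanField.Param d → ℝ) =ᵐ[volume]
          fun θ => MeanField.boltzmannWeight R Ψ g β ρ θ / MeanField.partitionFn R Ψ g β ρ) ∧
      ∃! ρ : MeanField.densities d, Function.IsFixedPt T ρ :=
  proposition2_general ((MeanField.convexOn_risk hR_convex hΨ).subset (Set.subset_univ _)
    MeanField.convex_probDensities)
    (fun ρ _ => MeanField.hasL1Gradient_risk hR_diff hΨ ρ) hβ.le (hg_conf.2 β hβ)
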